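/- Let $S$ be a once-punctured torus, with $\pi_1(S)=\langle a,b_0\rangle$ free on two generators $a,b_0$ whose commutator $[a,b_0]$ is a loop around the puncture. For coprime integers $p,q$ let the $p/q$ curve be the essential simple closed curve with homology class $\pm(p[a]+q[b_0])$; for an integer $m$, the $m/1$ curve is represented by $a^m b_0$ and the $(m+\tfrac12)$ curve, of slope $(2m+1)/2$, by $a^{m+1}b_0\,a^{m}b_0$. Let $X$ be the set of conjugacy classes of irreducible representations $\rho:\pi_1(S)\to \mathrm{PSL}(2,\mathbb C)$ sending peripheral elements to parabolic elements. Such a $\rho$ is called quasi-Fuchsian if it is faithful and its image is a discrete group whose domain of discontinuity in $\mathbb{C}P^1$ consists of exactly two open (topological) disks. For $l>0$ and $\tau\in\mathbb C$, let $(l,\tau)$ denote the point of $X$ with complex Fenchel–Nielsen coordinates $(l,\tau)$, that is, the class $[\rho]$ such that $\rho$ has a lift $\tilde\rho$ to $\mathrm{SL}(2,\mathbb C)$ with $$\bigl(\operatorname{tr}\tilde\rho(a),\operatorname{tr}\tilde\rho(b_0),\operatorname{tr}\tilde\rho(ab_0)\bigr)=\left(2\cosh\tfrac{l}{2},\ \frac{2\cosh(\tau/2)}{\tanh(l/2)},\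 \frac{2\cosh((\tau+l)/2)}{\tanh(l/2)}\right).$$ **Proposition.** Let $l>0$, $n\in\mathbb Z$ and $b\in\mathbb R$. 1. If $2\arccos(\tanh(l/2))<b<\pi$, then the holonomy of $(l,\,nl+b\sqrt{-1})$ along the $-n/1$ curve is elliptic, and $(l,\,nl+b\sqrt{-1})$ is not quasi-Fuchsian. 2. If $\arccos\!\left(\tanh^2(l/2)-\dfrac{1}{\cosh(l/2)}\right)<b<\pi$, then the holonomy of $(l,\,(n+\tfrac12)l+b\sqrt{-1})$ along the $(-n-\tfrac12)$ curve is elliptic, and $(l,\,(n+\tfrac12)l+b\sqrt{-1})$ is not quasi-Fuchsian. -/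

import Mathlib

open scoped Topology MatrixGroups

noncomputable section

namespace OncePuncturedTorus

/-- `SL(2, ℂ)`. -/
abbrev SL2C : Type := Matrix.SpecialLinearGroup (Fin 2) ℂ

/-- `PSL(2, ℂ) = SL(2, ℂ) / {± 1}`, with the quotient topology. -/
abbrev PSL2C : Type := Matrix.ProjectiveSpecialLinearGroup (Fin 2) ℂ

/-- The quotient map `SL(2, ℂ) → PSL(2, ℂ)`. -/
def toPSL : SL2C →* PSL2C := QuotientGroup.mk' (Subgroup.center SL2C)

/-! ### Hyperbolic 3-space and elements of `PSL(2, ℂ)` -/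

/-- The upper half-space model of hyperbolic 3-space: the points `(z, t)` with `z ∈ ℂ`, `t > 0`. -/
def upperHalfSpace : Set (ℂ × ℝ) := {p | 0 < p.2}

/-- The Poincaré extension: the action of `SL(2, ℂ)` on the upper half-space by orientation
preserving isometries. With `A = (a, b; c, d)`, the point `(z, t)` goes to
`(((az + b) conj (cz + d) + a conj(c) t²) / N, t / N)`, where `N = |cz + d|² + |c|² t²`. -/
def isometryAct (A : SL2C) (p : ℂ × ℝ) : ℂ × ℝ :=
  let N : ℝ := ‖A 1 0 * p.1 + A 1 1‖ ^ 2 + ‖A 1 0‖ ^ 2 * p.2 ^ 2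
  (((A 0 0 * p.1 + A 0 1) * (starRingEnd ℂ) (A 1 0 * p.1 + A 1 1)
      + A 0 0 * (starRingEnd ℂ) (A 1 0) * (p.2 : ℂ) ^ 2) / (N : ℂ), p.2 / N)

/-- An element of `PSL(2, ℂ)` is parabolic if a (equivalently, each) matrix representing it is not
scalar and has discriminant `0` (trace `± 2`). -/
def IsParabolicElement (g : PSL2C) : Prop :=
  ∃ A : SL2C, toPSL A = g ∧ (A : Matrix (Fin 2) (Fin 2) ℂ).IsParabolic

/-- An element of `PSL(2, ℂ)` is elliptic if it is not the identity and, as an isometry of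
hyperbolic 3-space, it has a fixed point in hyperbolic 3-space. -/
def IsEllipticElement (g : PSL2C) : Prop :=
  g ≠ 1 ∧ ∃ A : SL2C, toPSL A = g ∧ ∃ p ∈ upperHalfSpace, isometryAct A p = p

/-! ### Limit sets and quasi-Fuchsian groups -/

/-- The orbit of a point of the upper half-space under a subgroup of `PSL(2, ℂ)`. -/
def orbit (Γ : Subgroup PSL2C) (p : ℂ × ℝ) : Set (ℂ × ℝ) :=
  {q | ∃ A : SL2C, toPSL A ∈ Γ ∧ q = isometryAct A p}

/-- The inclusion of the ideal boundary, the Riemann sphere `ℂ ∪ {∞}`, into the one-point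
compactification of `ℂ × ℝ`, in which the closure of the upper half-space is the usual
compactification of hyperbolic 3-space. -/
def boundaryIncl : OnePoint ℂ → OnePoint (ℂ × ℝ) :=
  OnePoint.map (fun z : ℂ => (z, (0 : ℝ)))

/-- The limit set: the points of the ideal boundary at which an orbit `Γ p` of a point `p` of
hyperbolic 3-space accumulates (the choice of `p` does not matter). -/
def limitSet (Γ : Subgroup PSL2C) : Set (OnePoint ℂ) :=
  {ξ | ∃ p ∈ upperHalfSpace,
    AccPt (boundaryIncl ξ)
      (Filter.principal ((fun q : ℂ × ℝ => (q : OnePoint (ℂ × ℝ))) '' orbit Γ p))}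

/-- The domain of discontinuity. -/
def domainOfDiscontinuity (Γ : Subgroup PSL2C) : Set (OnePoint ℂ) := (limitSet Γ)ᶜ

/-- An open (topological) disk in the Riemann sphere. -/
def IsOpenDisk (U : Set (OnePoint ℂ)) : Prop :=
  IsOpen U ∧ Nonempty (U ≃ₜ Metric.ball (0 : ℂ) 1)

/-- The fundamental group of the once-punctured torus: the free group on two generators `a`, `b`
(with indices `0`, `1`), chosen so that the commutator `[a, b]` is a loop around the puncture. -/
abbrev SurfaceGroup : Type := FreeGroup (Fin 2)

/-- The first free generator of the fundamental group. -/
def genA : SurfaceGroup := FreeGroup.of 0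

/-- The second free generator of the fundamental group. -/
def genB : SurfaceGroup := FreeGroup.of 1

/-- Quasi-Fuchsian (once-punctured torus) groups: discrete subgroups of `PSL(2, ℂ)` isomorphic to
the fundamental group of the surface, whose domain of discontinuity consists of exactly two open
disks. -/
def IsQuasiFuchsianGroup (Γ : Subgroup PSL2C) : Prop :=
  DiscreteTopology Γ ∧ Nonempty (Γ ≃* SurfaceGroup) ∧
    ∃ U V : Set (OnePoint ℂ), IsOpenDisk U ∧ IsOpenDisk V ∧ Disjoint U V ∧
      domainOfDiscontinuity Γ = U ∪ V

/-! ### The character variety -/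

/-- Irreducible representations of the fundamental group into `PSL(2, ℂ)` (no common fixed point on
the complex projective line) which take the peripheral elements to parabolic elements. Peripheral
elements are the conjugates of the nonzero powers of `[a, b]`, and all of them are sent to parabolic
elements as soon as `[a, b]` is. -/
structure TypePreservingRep where
  /-- The underlying homomorphism. -/
  hom : SurfaceGroup →* PSL2C
  parabolic : IsParabolicElement (hom (genA * genB * genA⁻¹ * genB⁻¹))
  irreducible : ¬ ∃ ξ : Projectivization ℂ (Fin 2 → ℂ), ∀ w : SurfaceGroup, hom w • ξ = ξ

/-- Conjugacy of representations. -/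
def conjSetoid : Setoid TypePreservingRep where
  r ρ σ := ∃ h : PSL2C, ∀ w, σ.hom w = h * ρ.hom w * h⁻¹
  iseqv :=
    { refl := fun _ => ⟨1, fun w => by simp⟩
      symm := by
        rintro ρ σ ⟨h, hh⟩
        exact ⟨h⁻¹, fun w => by rw [hh w]; group⟩
      trans := by
        rintro ρ σ τ ⟨h, hh⟩ ⟨k, hk⟩
        exact ⟨k * h, fun w => by rw [hk w, hh w]; group⟩ }

/-- The `PSL(2, ℂ)`-character variety `X_par(S)` of the once-punctured torus `S`. -/
def CharacterVariety : Type := Quotient conjSetoid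

/-- The conjugacy class of a representation. -/
def conjClass (ρ : TypePreservingRep) : CharacterVariety := Quotient.mk conjSetoid ρ

/-- A representation is quasi-Fuchsian if it is faithful with quasi-Fuchsian image. -/
def TypePreservingRep.IsQuasiFuchsian (ρ : TypePreservingRep) : Prop :=
  Function.Injective ρ.hom ∧ IsQuasiFuchsianGroup ρ.hom.range

/-- The space `QF(S)` of conjugacy classes of quasi-Fuchsian representations. -/
def QF : Set CharacterVariety := {x | ∃ ρ : TypePreservingRep, conjClass ρ = x ∧ ρ.IsQuasiFuchsian}

/-- The point `x` of the character variety has an `SL(2, ℂ)`-lift with trace coordinates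
`(tr ρ(a), tr ρ(b), tr ρ(ab)) = (t₁, t₂, t₃)`. Different lifts differ by the sign changes
`(- t₁, t₂, - t₃)`, `(t₁, - t₂, - t₃)`, `(- t₁, - t₂, t₃)`. -/
def HasTraceCoordinates (x : CharacterVariety) (t₁ t₂ t₃ : ℂ) : Prop :=
  ∃ (ρ : TypePreservingRep) (A B : SL2C), conjClass ρ = x ∧
    toPSL A = ρ.hom genA ∧ toPSL B = ρ.hom genB ∧
    (A : Matrix (Fin 2) (Fin 2) ℂ).trace = t₁ ∧ (B : Matrix (Fin 2) (Fin 2) ℂ).trace = t₂ ∧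
    ((A * B : SL2C) : Matrix (Fin 2) (Fin 2) ℂ).trace = t₃

/-- `x` is the point with complex Fenchel-Nielsen coordinates `(lam, tau)`: the length parameter
`lam` is the complex length of `a`, and `tau` is the twist parameter. -/
def HasFenchelNielsenCoordinates (x : CharacterVariety) (lam tau : ℂ) : Prop :=
  HasTraceCoordinates x (2 * Complex.cosh (lam / 2))
    (2 * Complex.cosh (tau / 2) / Complex.tanh (lam / 2))
    (2 * Complex.cosh ((tau + lam) / 2) / Complex.tanh (lam / 2))

/-- The coordinates are attained: for every length parameter with `0 < Re lam`, `|Im lam| < π` (more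
generally when `cosh (lam / 2)` and `sinh (lam / 2)` do not vanish) and every twist parameter there
is a point of the character variety with these complex Fenchel-Nielsen coordinates. -/
theorem exists_hasFenchelNielsenCoordinates (lam tau : ℂ) (hs : Complex.sinh (lam / 2) ≠ 0)
    (hc : Complex.cosh (lam / 2) ≠ 0) :
    ∃ x : CharacterVariety, HasFenchelNielsenCoordinates x lam tau := by
  set e : ℂ := Complex.exp (lam / 2) with he
  set u : ℂ := Complex.exp (tau / 2) with hu
  have he0 : e ≠ 0 := Complex.exp_ne_zero _
  have hu0 : u ≠ 0 := Complex.exp_ne_zero _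
  set C : ℂ := Complex.cosh (lam / 2) / Complex.sinh (lam / 2) with hC
  have hC0 : C ≠ 0 := div_ne_zero hc hs
  have hsq : Complex.cosh (lam / 2) ^ 2 - Complex.sinh (lam / 2) ^ 2 = 1 :=
    Complex.cosh_sq_sub_sinh_sq _
  have hC1 : C ^ 2 - 1 ≠ 0 := by
    have : C ^ 2 - 1 = 1 / Complex.sinh (lam / 2) ^ 2 := by
      rw [hC]; field_simp; exact hsq
    rw [this]
    exact one_div_ne_zero (pow_ne_zero _ hs)
  have hch : 2 * Complex.cosh (lam / 2) = e + e⁻¹ := by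
    rw [Complex.two_cosh, Complex.exp_neg]
  have hsh : 2 * Complex.sinh (lam / 2) = e - e⁻¹ := by
    rw [Complex.two_sinh, Complex.exp_neg]
  have he1 : e - e⁻¹ ≠ 0 := by rw [← hsh]; exact mul_ne_zero two_ne_zero hs
  have hCe : C * (e - e⁻¹) = e + e⁻¹ := by
    rw [← hsh, ← hch, hC]; field_simp
  obtain ⟨A, hA⟩ : ∃ A : SL2C, (A : Matrix (Fin 2) (Fin 2) ℂ) = !![e, 0; 0, e⁻¹] :=
    ⟨⟨!![e, 0; 0, e⁻¹], by simp [Matrix.det_fin_two, he0]⟩, rfl⟩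
  obtain ⟨B, hB⟩ : ∃ B : SL2C,
      (B : Matrix (Fin 2) (Fin 2) ℂ) = !![C * u, C ^ 2 - 1; 1, C * u⁻¹] :=
    ⟨⟨!![C * u, C ^ 2 - 1; 1, C * u⁻¹], by rw [Matrix.det_fin_two_of]; field_simp; ring⟩, rfl⟩
  have hAB : ((A * B : SL2C) : Matrix (Fin 2) (Fin 2) ℂ) =
      !![e * (C * u), e * (C ^ 2 - 1); e⁻¹, e⁻¹ * (C * u⁻¹)] := by
    rw [Matrix.SpecialLinearGroup.coe_mul, hA, hB, Matrix.mul_fin_two]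
    simp
  let f : SurfaceGroup →* PSL2C := FreeGroup.lift ![toPSL A, toPSL B]
  have hfA : f genA = toPSL A := by simp [f, genA]
  have hfB : f genB = toPSL B := by simp [f, genB]
  have hpar : IsParabolicElement (f (genA * genB * genA⁻¹ * genB⁻¹)) := by
    refine ⟨A * B * A⁻¹ * B⁻¹, by simp [hfA, hfB], ?_⟩
    have hM : ((A * B * A⁻¹ * B⁻¹ : SL2C) : Matrix (Fin 2) (Fin 2) ℂ) =
        !![C ^ 2 - e ^ 2 * (C ^ 2 - 1), (e ^ 2 - 1) * (C ^ 2 - 1) * (C * u);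
          (e⁻¹ ^ 2 - 1) * (C * u⁻¹), C ^ 2 - e⁻¹ ^ 2 * (C ^ 2 - 1)] := by
      rw [Matrix.SpecialLinearGroup.coe_mul, Matrix.SpecialLinearGroup.coe_mul, hAB,
        Matrix.SpecialLinearGroup.coe_inv, Matrix.SpecialLinearGroup.coe_inv, hA, hB,
        Matrix.adjugate_fin_two_of, Matrix.adjugate_fin_two_of, Matrix.mul_fin_two,
        Matrix.mul_fin_two]
      ext i j
      fin_cases i <;> fin_cases j <;> simp <;> field_simp <;> ring
    have hdet := (A * B * A⁻¹ * B⁻¹).det_coe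
    have htr : ((A * B * A⁻¹ * B⁻¹ : SL2C) : Matrix (Fin 2) (Fin 2) ℂ).trace = -2 := by
      rw [hM, Matrix.trace_fin_two_of]
      have hee : e * e⁻¹ = 1 := mul_inv_cancel₀ he0
      have h4 : (C ^ 2 - 1) * (e - e⁻¹) ^ 2 = 4 := by
        linear_combination (C * (e - e⁻¹) + (e + e⁻¹)) * hCe + 4 * hee
      linear_combination -h4 - 2 * (C ^ 2 - 1) * hee
    refine ⟨?_, ?_⟩
    · rw [hM]
      rintro ⟨c, h⟩
      have h10 := congrFun (congrFun h 1) 0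
      simp only [Matrix.scalar_apply, Matrix.diagonal_apply, Matrix.of_apply, Matrix.cons_val_zero,
        Matrix.cons_val_one] at h10
      simp only [one_ne_zero, if_false] at h10
      have h2 := (mul_eq_zero.1 h10.symm).resolve_right (mul_ne_zero hC0 (inv_ne_zero hu0))
      apply mul_ne_zero he1 (inv_ne_zero he0)
      have hee : e * e⁻¹ = 1 := mul_inv_cancel₀ he0
      linear_combination hee - h2
    · rw [Matrix.discr_fin_two, htr, hdet]
      norm_num
  have hirr : ¬ ∃ ξ : Projectivization ℂ (Fin 2 → ℂ), ∀ w : SurfaceGroup, f w • ξ = ξ := by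
    rintro ⟨ξ, hξ⟩
    have h1 : A • ξ = ξ := by
      have := hξ genA
      rwa [hfA] at this
    have h2 : B • ξ = ξ := by
      have := hξ genB
      rwa [hfB] at this
    induction ξ using Projectivization.ind with
    | h v hv =>
      rw [Projectivization.smul_mk, Projectivization.mk_eq_mk_iff'] at h1 h2
      obtain ⟨c, hc⟩ := h1
      obtain ⟨d, hd⟩ := h2
      have hc' : c • v = (A : Matrix (Fin 2) (Fin 2) ℂ).mulVec v := hc
      have hd' : d • v = (B : Matrix (Fin 2) (Fin 2) ℂ).mulVec v := hd
      rw [hA] at hc'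
      rw [hB] at hd'
      have c0 := congrFun hc' 0
      have c1 := congrFun hc' 1
      have d0 := congrFun hd' 0
      have d1 := congrFun hd' 1
      simp [Matrix.mulVec, dotProduct, Fin.sum_univ_two] at c0 c1 d0 d1
      have hv' : v 0 ≠ 0 ∨ v 1 ≠ 0 := by
        by_contra! h
        exact hv (funext fun i => by fin_cases i <;> simp [h.1, h.2])
      by_cases hv1 : v 1 = 0
      · rw [hv1] at d1
        simp at d1
        simp_all
      · by_cases hv0 : v 0 = 0
        · rw [hv0] at d0
          simp [hv1] at d0
          exact hC1 d0
        · have e1 : c = e := by simpa [hv0] using c0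
          have e2 : c = e⁻¹ := by simpa [hv1] using c1
          exact he1 (by rw [← e2, ← e1, sub_self])
  refine ⟨conjClass ⟨f, hpar, hirr⟩, ⟨f, hpar, hirr⟩, A, B, rfl, hfA.symm, hfB.symm, ?_, ?_, ?_⟩
  · rw [hch, hA, Matrix.trace_fin_two_of]
  · rw [Complex.two_cosh, Complex.exp_neg, ← hu, Complex.tanh_eq_sinh_div_cosh, hB,
      Matrix.trace_fin_two_of, hC]
    field_simp
  · rw [Complex.two_cosh, Complex.exp_neg, add_div tau lam 2, Complex.exp_add, ← hu, ← he,
      Complex.tanh_eq_sinh_div_cosh, hAB, Matrix.trace_fin_two_of, hC]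
    field_simp

/-! ### Simple closed curves

The slope `p / q` stands for the essential simple closed curve with homology class `± (p [a] + q [b])`.
For Farey neighbours `p / q < r / s`, the curve of slope `(p + r) / (q + s)` is represented by the
product of the word of slope `r / s` and the word of slope `p / q`. -/

/-- A word representing the simple closed curve of slope `m / 1`. -/
def curveInt (m : ℤ) : SurfaceGroup := genA ^ m * genB

/-- A word representing the simple closed curve of slope `m + 1 / 2 = (2 m + 1) / 2`, the mediant of
the slopes `m / 1` and `(m + 1) / 1`. -/
def curveHalf (m : ℤ) : SurfaceGroup := curveInt (m + 1) * curveInt m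

/-- The holonomy of the conjugacy class `x` along the curve represented by `w` is elliptic. -/
def EllipticHolonomy (x : CharacterVariety) (w : SurfaceGroup) : Prop :=
  ∀ ρ : TypePreservingRep, conjClass ρ = x → IsEllipticElement (ρ.hom w)

end OncePuncturedTorus

end

namespace OncePuncturedTorus

/-! ### Traces in `SL(2, ℂ)` -/

/-! In each case the curve's holonomy lifts to a matrix whose trace is an explicit function of the
coordinates (`exists_lift_curveInt`, `exists_lift_curveHalf`). The twisting in the chosen slope
cancels the real part of the twist parameter, so only `b * I` remains, `cosh` becomes `cos`, and the
trace is real. The lower bound on `b` is the condition that this trace be less than 2, so the trace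
lies in (-2, 2) and the holonomy is elliptic. A discrete group has only finite-order elliptics
(`exists_toPSL_pow_eq_one`), while a faithful image of a free group is torsion-free; hence the point
is not quasi-Fuchsian. -/

theorem SL2C.coe_add_coe_inv (A : SL2C) :
    (A : Matrix (Fin 2) (Fin 2) ℂ) + (A⁻¹ : SL2C) =
      (A : Matrix (Fin 2) (Fin 2) ℂ).trace • (1 : Matrix (Fin 2) (Fin 2) ℂ) := by
  rw [Matrix.SpecialLinearGroup.coe_inv, Matrix.adjugate_fin_two]
  ext i j
  fin_cases i <;> fin_cases j <;> simp [Matrix.trace_fin_two, add_comm]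

theorem SL2C.trace_mul_add_trace_inv_mul (A B : SL2C) :
    ((A * B : SL2C) : Matrix (Fin 2) (Fin 2) ℂ).trace +
        ((A⁻¹ * B : SL2C) : Matrix (Fin 2) (Fin 2) ℂ).trace =
      (A : Matrix (Fin 2) (Fin 2) ℂ).trace * (B : Matrix (Fin 2) (Fin 2) ℂ).trace := by
  rw [Matrix.SpecialLinearGroup.coe_mul, Matrix.SpecialLinearGroup.coe_mul, ← Matrix.trace_add,
    ← add_mul, SL2C.coe_add_coe_inv, smul_mul_assoc, one_mul, Matrix.trace_smul, smul_eq_mul]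

theorem SL2C.trace_conj (A H : SL2C) :
    ((H * A * H⁻¹ : SL2C) : Matrix (Fin 2) (Fin 2) ℂ).trace =
      (A : Matrix (Fin 2) (Fin 2) ℂ).trace := by
  rw [Matrix.SpecialLinearGroup.coe_mul, Matrix.trace_mul_comm, ← Matrix.SpecialLinearGroup.coe_mul]
  rw [← mul_assoc, inv_mul_cancel, one_mul]

theorem SL2C.trace_inv (A : SL2C) :
    ((A⁻¹ : SL2C) : Matrix (Fin 2) (Fin 2) ℂ).trace = (A : Matrix (Fin 2) (Fin 2) ℂ).trace := by
  rw [Matrix.SpecialLinearGroup.coe_inv, Matrix.adjugate_fin_two, Matrix.trace_fin_two_of,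
    Matrix.trace_fin_two, add_comm]

theorem two_cosh_add_add_two_cosh_sub (x y : ℂ) :
    2 * Complex.cosh (x + y) + 2 * Complex.cosh (x - y) =
      2 * Complex.cosh y * (2 * Complex.cosh x) := by
  rw [Complex.cosh_add, Complex.cosh_sub]
  ring

/-- In Fenchel-Nielsen coordinates, a twist about `a` adds the length to the twist parameter. -/
theorem SL2C.trace_zpow_mul {A B : SL2C} {lam tau k : ℂ}
    (hA : (A : Matrix (Fin 2) (Fin 2) ℂ).trace = 2 * Complex.cosh (lam / 2))
    (hB : (B : Matrix (Fin 2) (Fin 2) ℂ).trace = 2 * Complex.cosh (tau / 2) / k)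
    (hAB : ((A * B : SL2C) : Matrix (Fin 2) (Fin 2) ℂ).trace =
      2 * Complex.cosh ((tau + lam) / 2) / k) (m : ℤ) :
    ((A ^ m * B : SL2C) : Matrix (Fin 2) (Fin 2) ℂ).trace =
      2 * Complex.cosh ((tau + m * lam) / 2) / k := by
  -- Both sides of the claim satisfy the same second-order recursion in the exponent, so agreement
  -- at 0 and 1 suffices; `key` carries two consecutive values.
  have hrec (j : ℤ) : ((A ^ (j + 1) * B : SL2C) : Matrix (Fin 2) (Fin 2) ℂ).trace +
      ((A ^ (j - 1) * B : SL2C) : Matrix (Fin 2) (Fin 2) ℂ).trace =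
      2 * Complex.cosh (lam / 2) * ((A ^ j * B : SL2C) : Matrix (Fin 2) (Fin 2) ℂ).trace := by
    rw [← hA, ← SL2C.trace_mul_add_trace_inv_mul]
    rw [← mul_assoc, ← mul_assoc, ← zpow_one_add, ← zpow_neg_one, ← zpow_add, add_comm 1 j,
      neg_add_eq_sub]
  have hcosh (j : ℂ) : 2 * Complex.cosh ((tau + (j + 1) * lam) / 2) / k +
      2 * Complex.cosh ((tau + (j - 1) * lam) / 2) / k =
      2 * Complex.cosh (lam / 2) * (2 * Complex.cosh ((tau + j * lam) / 2) / k) := by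
    rw [← add_div, ← mul_div_assoc, ← two_cosh_add_add_two_cosh_sub]
    ring_nf
  have key : ∀ j : ℤ, ((A ^ j * B : SL2C) : Matrix (Fin 2) (Fin 2) ℂ).trace =
        2 * Complex.cosh ((tau + j * lam) / 2) / k ∧
      ((A ^ (j + 1) * B : SL2C) : Matrix (Fin 2) (Fin 2) ℂ).trace =
        2 * Complex.cosh ((tau + (j + 1) * lam) / 2) / k := by
    intro j
    induction j using Int.induction_on with
    | zero => simpa using ⟨hB, hAB⟩
    | succ i ih =>
      refine ⟨by simpa using ih.2, ?_⟩
      have h1 := hrec (i + 1)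
      have h2 := hcosh (i + 1)
      rw [add_sub_cancel_right] at h1 h2
      rw [ih.1, ih.2] at h1
      push_cast at h1 ⊢
      linear_combination h1 - h2
    | pred i ih =>
      have h1 := hrec (-i)
      have h2 := hcosh (-i)
      rw [ih.1, ih.2] at h1
      push_cast at h1 h2 ih ⊢
      rw [sub_add_cancel, sub_add_cancel]
      refine ⟨by linear_combination h1 - h2, ih.1⟩
  exact (key m).1

/-! ### Elliptic elements -/

/-- Central matrices are scalars `r` with `r ^ 2 = 1`. This excludes the identity when the trace
lies in (-2, 2). -/
theorem trace_sq_eq_four_of_toPSL_eq_one {W : SL2C} (h : toPSL W = 1) :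
    (W : Matrix (Fin 2) (Fin 2) ℂ).trace ^ 2 = 4 := by
  have hW : W ∈ Subgroup.center SL2C := (QuotientGroup.eq_one_iff W).1 h
  obtain ⟨r, hr, hrW⟩ := Matrix.SpecialLinearGroup.mem_center_iff.1 hW
  rw [Fintype.card_fin] at hr
  rw [← hrW, Matrix.scalar_apply, Matrix.trace_diagonal]
  simp only [Finset.sum_const, Finset.card_univ, Fintype.card_fin, nsmul_eq_mul]
  push_cast
  linear_combination 4 * hr

/-- A matrix with real trace in `(-2, 2)` fixes the highest point of its axis (or, if the axis is
vertical, the point of height `1` on it). -/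
theorem exists_isometryAct_eq_self {W : SL2C} {t : ℝ}
    (hW : (W : Matrix (Fin 2) (Fin 2) ℂ).trace = t) (ht : |t| < 2) :
    ∃ p ∈ upperHalfSpace, isometryAct W p = p := by
  have ht4 : 0 < 4 - t ^ 2 := by nlinarith [sq_abs t, abs_nonneg t]
  have hdet : W 0 0 * W 1 1 - W 0 1 * W 1 0 = 1 := by
    rw [← Matrix.det_fin_two]; exact W.det_coe
  rw [Matrix.trace_fin_two] at hW
  by_cases hc : W 1 0 = 0
  · have had : W 0 0 * W 1 1 = 1 := by linear_combination hdet + W 0 1 * hc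
    have hd : W 1 1 - W 0 0 ≠ 0 := by
      intro h
      have h4 : (t : ℂ) ^ 2 = 4 := by
        linear_combination 4 * had + (W 1 1 - W 0 0) * h - (W 0 0 + W 1 1 + t) * hW
      norm_cast at h4
      linarith
    -- In the triangular case `W 1 1` is an eigenvalue, a root of `z ^ 2 - t z + 1`. As `|t| < 2`,
    -- the roots are non-real conjugates with product 1.
    have hnorm : W 1 1 * (starRingEnd ℂ) (W 1 1) = 1 := by
      have hroot : W 1 1 * W 1 1 - t * W 1 1 + 1 = 0 := by
        linear_combination W 1 1 * hW - had
      have hre := congrArg Complex.re hroot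
      have him := congrArg Complex.im hroot
      simp only [Complex.add_re, Complex.sub_re, Complex.mul_re, Complex.ofReal_re,
        Complex.ofReal_im, Complex.one_re, Complex.zero_re, Complex.add_im, Complex.sub_im,
        Complex.mul_im, Complex.one_im, Complex.zero_im] at hre him
      rw [Complex.mul_conj, Complex.normSq_apply]
      norm_cast
      have himz : (W 1 1).im * (2 * (W 1 1).re - t) = 0 := by linear_combination him
      rcases mul_eq_zero.1 himz with h | h
      · rw [h] at hre
        nlinarith [sq_nonneg (2 * (W 1 1).re - t)]
      · linear_combination -hre + (W 1 1).re * h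
    have hN : ‖W 1 1‖ ^ 2 = 1 := by
      rw [Complex.mul_conj'] at hnorm
      exact_mod_cast hnorm
    -- The finite fixed point of the affine map on `ℂ` is the foot of the vertical axis.
    refine ⟨(W 0 1 / (W 1 1 - W 0 0), 1), one_pos (α := ℝ), ?_⟩
    have hconj : (starRingEnd ℂ) (W 1 1) = W 0 0 := by
      linear_combination W 0 0 * hnorm - (starRingEnd ℂ) (W 1 1) * had
    simp only [isometryAct, hc, zero_mul, zero_add, norm_zero, map_zero, mul_zero, hN, hconj]
    ext
    · simp
      field_simp
      linear_combination W 0 1 * had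
    · simp
  · have hcn : 0 < ‖W 1 0‖ := norm_pos_iff.2 hc
    -- The boundary fixed points are `(W 0 0 - W 1 1 ± √(t ^ 2 - 4)) / (2 * W 1 0)`; `s` is half
    -- their distance, the radius of the semicircular axis.
    set s : ℝ := √(4 - t ^ 2) / (2 * ‖W 1 0‖) with hs
    have hs2 : ‖W 1 0‖ ^ 2 * s ^ 2 = (4 - t ^ 2) / 4 := by
      rw [hs, div_pow, Real.sq_sqrt ht4.le]
      field_simp
      norm_num
    have hcs : (starRingEnd ℂ) (W 1 0) * (s : ℂ) ^ 2 = (4 - t ^ 2) / (4 * W 1 0) := by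
      have h : W 1 0 * (starRingEnd ℂ) (W 1 0) * (s : ℂ) ^ 2 = (4 - t ^ 2) / 4 := by
        rw [Complex.mul_conj']
        exact_mod_cast hs2
      field_simp
      linear_combination 4 * h
    have hmid : W 1 0 * ((W 0 0 - W 1 1) / (2 * W 1 0)) + W 1 1 = ((t / 2 : ℝ) : ℂ) := by
      push_cast
      field_simp
      linear_combination hW
    have hN : ‖W 1 0 * ((W 0 0 - W 1 1) / (2 * W 1 0)) + W 1 1‖ ^ 2 + ‖W 1 0‖ ^ 2 * s ^ 2 = 1 := by
      rw [hmid, hs2, Complex.norm_real, Real.norm_eq_abs, sq_abs]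
      ring
    refine ⟨((W 0 0 - W 1 1) / (2 * W 1 0), s), ?_, ?_⟩
    · exact div_pos (Real.sqrt_pos.2 ht4) (by positivity)
    · simp only [isometryAct, hN]
      ext
      · rw [hmid, Complex.conj_ofReal, mul_assoc, hcs]
        push_cast
        field_simp
        rw [← hW]
        linear_combination (-8 * (W 0 0 + W 1 1)) * hdet
      · simp

theorem isEllipticElement_of_trace {W : SL2C} {t : ℝ}
    (hW : (W : Matrix (Fin 2) (Fin 2) ℂ).trace = t) (ht : |t| < 2) :
    IsEllipticElement (toPSL W) := by
  refine ⟨fun h => ?_, W, rfl, exists_isometryAct_eq_self hW ht⟩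
  have h4 := trace_sq_eq_four_of_toPSL_eq_one h
  rw [hW] at h4
  norm_cast at h4
  nlinarith [sq_abs t, abs_nonneg t]

/-! ### Elliptic elements of discrete groups have finite order -/

/-- Cayley–Hamilton turns powers into a Chebyshev recursion. The coefficients depend only on the
point of the circle at angle `n * θ`, which lets recurrence on the circle control the powers of `W`.
-/
theorem SL2C.coe_pow_eq {W : SL2C} {θ : ℝ}
    (hW : (W : Matrix (Fin 2) (Fin 2) ℂ).trace = (2 * Real.cos θ : ℝ)) (hθ : Real.sin θ ≠ 0)
    (n : ℕ) :
    ((W ^ n : SL2C) : Matrix (Fin 2) (Fin 2) ℂ) =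
      ((Real.sin (n * θ) / Real.sin θ : ℝ) : ℂ) • (W : Matrix (Fin 2) (Fin 2) ℂ) +
      ((Real.cos (n * θ) - Real.cos θ * (Real.sin (n * θ) / Real.sin θ) : ℝ) : ℂ) •
        (1 : Matrix (Fin 2) (Fin 2) ℂ) := by
  have hsq : (W : Matrix (Fin 2) (Fin 2) ℂ) * W =
      ((2 * Real.cos θ : ℝ) : ℂ) • (W : Matrix (Fin 2) (Fin 2) ℂ) - 1 := by
    have h := congrArg (· * (W : Matrix (Fin 2) (Fin 2) ℂ)) (SL2C.coe_add_coe_inv W)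
    simp only [add_mul, smul_mul_assoc, one_mul, hW] at h
    rw [← Matrix.SpecialLinearGroup.coe_mul W⁻¹, inv_mul_cancel,
      Matrix.SpecialLinearGroup.coe_one] at h
    exact eq_sub_of_add_eq h
  induction n with
  | zero => simp
  | succ n ih =>
    rw [pow_succ, Matrix.SpecialLinearGroup.coe_mul, ih, add_mul, smul_mul_assoc, smul_mul_assoc,
      one_mul, hsq]
    have h1 : Real.sin ((n + 1 : ℕ) * θ) / Real.sin θ =
        2 * Real.cos θ * (Real.sin (n * θ) / Real.sin θ) +
          (Real.cos (n * θ) - Real.cos θ * (Real.sin (n * θ) / Real.sin θ)) := by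
      push_cast
      rw [add_mul, one_mul, Real.sin_add]
      field_simp
      ring
    have h2 : Real.cos ((n + 1 : ℕ) * θ) -
        Real.cos θ * (Real.sin ((n + 1 : ℕ) * θ) / Real.sin θ) =
        -(Real.sin (n * θ) / Real.sin θ) := by
      rw [h1]
      push_cast
      rw [add_mul, one_mul, Real.cos_add]
      field_simp
      linear_combination (-Real.sin (n * θ)) * Real.sin_sq_add_cos_sq θ
    rw [h2, h1]
    push_cast
    module

/-- A representative with real trace in `(-2, 2)` of an element of a discrete group has a nontrivial
power representing the identity. -/
theorem exists_toPSL_pow_eq_one {Γ : Subgroup PSL2C} [DiscreteTopology Γ] {W : SL2C} {t : ℝ}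
    (hW : (W : Matrix (Fin 2) (Fin 2) ℂ).trace = t) (ht : |t| < 2) (hΓ : toPSL W ∈ Γ) :
    ∃ n : ℕ, 0 < n ∧ toPSL W ^ n = 1 := by
  obtain ⟨ht1, ht2⟩ := abs_lt.1 ht
  set θ : ℝ := Real.arccos (t / 2)
  have hcos : Real.cos θ = t / 2 := Real.cos_arccos (by linarith) (by linarith)
  have hsin : Real.sin θ ≠ 0 := by
    intro h
    have := Real.sin_sq_add_cos_sq θ
    rw [h, hcos] at this
    nlinarith
  have hW' : (W : Matrix (Fin 2) (Fin 2) ℂ).trace = (2 * Real.cos θ : ℝ) := by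
    rw [hW, hcos, mul_div_cancel₀ _ two_ne_zero]
  obtain ⟨V, hV, hVΓ⟩ := isOpen_induced_iff.1 (isOpen_discrete ({1} : Set Γ))
  have hcont : Continuous toPSL := continuous_quot_mk
  obtain ⟨O, hO, hOV⟩ := isOpen_induced_iff.1 (hV.preimage hcont)
  -- `F` is a continuous map with `F (exp (i n θ)) = W ^ n`.
  let F : Circle → Matrix (Fin 2) (Fin 2) ℂ := fun z =>
    (((z : ℂ).im / Real.sin θ : ℝ) : ℂ) • (W : Matrix (Fin 2) (Fin 2) ℂ) +
      (((z : ℂ).re - Real.cos θ * ((z : ℂ).im / Real.sin θ) : ℝ) : ℂ) •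
        (1 : Matrix (Fin 2) (Fin 2) ℂ)
  have hF : Continuous F := by
    have hre : Continuous fun z : Circle => (z : ℂ).re :=
      Complex.continuous_re.comp continuous_subtype_val
    have him : Continuous fun z : Circle => (z : ℂ).im :=
      Complex.continuous_im.comp continuous_subtype_val
    fun_prop
  have hpow (n : ℕ) : F (Circle.exp θ ^ n) = ((W ^ n : SL2C) : Matrix (Fin 2) (Fin 2) ℂ) := by
    rw [SL2C.coe_pow_eq hW' hsin, ← Circle.exp_nsmul]
    simp only [F, Circle.coe_exp, Complex.exp_ofReal_mul_I_im, Complex.exp_ofReal_mul_I_re,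
      nsmul_eq_mul]
  have hmem (g : SL2C) : toPSL g ∈ V ↔ (g : Matrix (Fin 2) (Fin 2) ℂ) ∈ O := by
    exact (Set.ext_iff.1 hOV g).symm
  have h1 : F 1 ∈ O := by
    have h := hpow 0
    rw [pow_zero, pow_zero] at h
    rw [h, ← hmem, map_one]
    exact (Set.ext_iff.1 hVΓ 1).2 rfl
  -- Powers of any circle element return near 1 for arbitrarily large exponents, whether or not `θ /
  -- π` is rational. Such a power of `W` lands in the neighbourhood `V` isolating 1 in `Γ`.
  have hfreq := (mapClusterPt_one_atTop_pow (Circle.exp θ)).frequently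
    ((hO.preimage hF).mem_nhds h1)
  obtain ⟨n, hnO, hn⟩ := (hfreq.and_eventually (Filter.eventually_gt_atTop 0)).exists
  refine ⟨n, hn, ?_⟩
  have hnV : toPSL (W ^ n) ∈ V := by
    rw [hmem, ← hpow]
    exact hnO
  rw [map_pow] at hnV
  exact congrArg Subtype.val ((Set.ext_iff.1 hVΓ ⟨_, Γ.pow_mem hΓ n⟩).1 hnV)

/-! ### Representations with given Fenchel-Nielsen coordinates -/

/-- The coordinates come with one representative of the class; conjugating its lifts serves every
other one. -/
theorem HasTraceCoordinates.exists_lift {x : CharacterVariety} {t₁ t₂ t₃ : ℂ}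
    (h : HasTraceCoordinates x t₁ t₂ t₃) {ρ : TypePreservingRep} (hρ : conjClass ρ = x) :
    ∃ A B : SL2C, toPSL A = ρ.hom genA ∧ toPSL B = ρ.hom genB ∧
      (A : Matrix (Fin 2) (Fin 2) ℂ).trace = t₁ ∧ (B : Matrix (Fin 2) (Fin 2) ℂ).trace = t₂ ∧
      ((A * B : SL2C) : Matrix (Fin 2) (Fin 2) ℂ).trace = t₃ := by
  obtain ⟨σ, A, B, hσ, hA, hB, h1, h2, h3⟩ := h
  obtain ⟨g, hg⟩ : ∃ g : PSL2C, ∀ w, ρ.hom w = g * σ.hom w * g⁻¹ :=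
    Quotient.exact (s := conjSetoid) (hσ.trans hρ.symm)
  obtain ⟨H, rfl⟩ : ∃ H, toPSL H = g := QuotientGroup.mk'_surjective _ g
  refine ⟨H * A * H⁻¹, H * B * H⁻¹, ?_, ?_, ?_, ?_, ?_⟩
  · rw [hg, ← hA, map_mul, map_mul, map_inv]
  · rw [hg, ← hB, map_mul, map_mul, map_inv]
  · rw [SL2C.trace_conj, h1]
  · rw [SL2C.trace_conj, h2]
  · rw [← h3, ← SL2C.trace_conj (A * B) H]
    simp only [mul_assoc, inv_mul_cancel_left]

theorem ellipticHolonomy_and_notMem_QF {x : CharacterVariety} {w : SurfaceGroup} {t : ℝ}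
    (ht : |t| < 2)
    (h : ∀ ρ : TypePreservingRep, conjClass ρ = x →
      ∃ W : SL2C, toPSL W = ρ.hom w ∧ (W : Matrix (Fin 2) (Fin 2) ℂ).trace = t) :
    EllipticHolonomy x w ∧ x ∉ QF := by
  have hell : EllipticHolonomy x w := by
    intro ρ hρ
    obtain ⟨W, hW, htr⟩ := h ρ hρ
    rw [← hW]
    exact isEllipticElement_of_trace htr ht
  refine ⟨hell, ?_⟩
  rintro ⟨ρ, hρ, hinj, hdisc, -, -⟩
  obtain ⟨W, hW, htr⟩ := h ρ hρ
  obtain ⟨n, hn, hpow⟩ := exists_toPSL_pow_eq_one (Γ := ρ.hom.range) htr ht (hW ▸ ⟨w, rfl⟩)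
  rw [hW, ← map_pow] at hpow
  have hw : w ^ n = 1 := hinj (hpow.trans (map_one _).symm)
  have hw1 : w = 1 := (pow_eq_one_iff_left hn.ne').1 hw
  exact (hell ρ hρ).1 (by rw [hw1, map_one])

theorem HasFenchelNielsenCoordinates.exists_lift_curveInt {x : CharacterVariety} {lam tau : ℂ}
    (h : HasFenchelNielsenCoordinates x lam tau) {ρ : TypePreservingRep} (hρ : conjClass ρ = x)
    (m : ℤ) :
    ∃ W : SL2C, toPSL W = ρ.hom (curveInt m) ∧ (W : Matrix (Fin 2) (Fin 2) ℂ).trace =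
      2 * Complex.cosh ((tau + m * lam) / 2) / Complex.tanh (lam / 2) := by
  obtain ⟨A, B, hA, hB, h1, h2, h3⟩ := HasTraceCoordinates.exists_lift h hρ
  refine ⟨A ^ m * B, ?_, SL2C.trace_zpow_mul h1 h2 h3 m⟩
  rw [curveInt, map_mul, map_mul, map_zpow, map_zpow, hA, hB]

theorem HasFenchelNielsenCoordinates.exists_lift_curveHalf {x : CharacterVariety} {lam tau : ℂ}
    (h : HasFenchelNielsenCoordinates x lam tau) {ρ : TypePreservingRep} (hρ : conjClass ρ = x)
    (m : ℤ) :
    ∃ W : SL2C, toPSL W = ρ.hom (curveHalf m) ∧ (W : Matrix (Fin 2) (Fin 2) ℂ).trace =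
      2 * (Complex.cosh (tau + m * lam + lam / 2) + Complex.cosh (lam / 2)) /
        Complex.tanh (lam / 2) ^ 2 - 2 * Complex.cosh (lam / 2) := by
  obtain ⟨A, B, hA, hB, h1, h2, h3⟩ := HasTraceCoordinates.exists_lift h hρ
  refine ⟨A ^ (m + 1) * B * (A ^ m * B), ?_, ?_⟩
  · simp only [curveHalf, curveInt, map_mul, map_zpow, hA, hB]
  -- For Farey neighbours `X`, `Y`, the element `X⁻¹ * Y` is conjugate to `A⁻¹`, so `tr (X * Y) = tr
  -- X * tr Y - tr A`.
  · have hinv : (A ^ (m + 1) * B)⁻¹ * (A ^ m * B) = B⁻¹ * A⁻¹ * B⁻¹⁻¹ := by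
      group
    have hmul := SL2C.trace_mul_add_trace_inv_mul (A ^ (m + 1) * B) (A ^ m * B)
    rw [hinv, SL2C.trace_conj, SL2C.trace_inv, h1, SL2C.trace_zpow_mul h1 h2 h3,
      SL2C.trace_zpow_mul h1 h2 h3] at hmul
    have hcosh := two_cosh_add_add_two_cosh_sub ((tau + (m + 1) * lam) / 2) ((tau + m * lam) / 2)
    rw [show (tau + (m + 1) * lam) / 2 + (tau + m * lam) / 2 = tau + m * lam + lam / 2 by ring,
      show (tau + (m + 1) * lam) / 2 - (tau + m * lam) / 2 = lam / 2 by ring] at hcosh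
    rw [eq_sub_iff_add_eq, hmul, mul_add, hcosh]
    push_cast
    ring

/-! ### Trace estimates -/

theorem abs_two_mul_cos_div_tanh_lt_two {l b : ℝ} (hl : 0 < l)
    (hb : 2 * Real.arccos (Real.tanh (l / 2)) < b) (hbπ : b < Real.pi) :
    |2 * Real.cos (b / 2) / Real.tanh (l / 2)| < 2 := by
  have htanh : 0 < Real.tanh (l / 2) := by
    rw [Real.tanh_eq_sinh_div_cosh]
    exact div_pos (Real.sinh_pos_iff.2 (by linarith)) (Real.cosh_pos _)
  have harc := Real.arccos_nonneg (Real.tanh (l / 2))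
  have hcos0 : 0 < Real.cos (b / 2) :=
    Real.cos_pos_of_mem_Ioo ⟨by linarith [Real.pi_pos], by linarith⟩
  have hcos : Real.cos (b / 2) < Real.tanh (l / 2) := by
    have h := Real.cos_lt_cos_of_nonneg_of_le_pi harc (by linarith [Real.pi_pos])
      (show Real.arccos (Real.tanh (l / 2)) < b / 2 by linarith)
    rwa [Real.cos_arccos (Real.neg_one_lt_tanh _).le (Real.tanh_lt_one _).le] at h
  rw [abs_of_pos (by positivity), div_lt_iff₀ htanh]
  linarith

theorem abs_trace_half_lt_two {l b : ℝ} (hl : 0 < l)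
    (hb : Real.arccos (Real.tanh (l / 2) ^ 2 - 1 / Real.cosh (l / 2)) < b) (hbπ : b < Real.pi) :
    |2 * (Real.cos b + Real.cosh (l / 2)) / Real.tanh (l / 2) ^ 2 - 2 * Real.cosh (l / 2)| < 2 := by
  have hc : 1 < Real.cosh (l / 2) := Real.one_lt_cosh.2 (by linarith)
  have hs2 : Real.sinh (l / 2) ^ 2 = Real.cosh (l / 2) ^ 2 - 1 := by
    linarith [Real.cosh_sq (l / 2)]
  have hT : Real.tanh (l / 2) ^ 2 = 1 - 1 / Real.cosh (l / 2) ^ 2 := by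
    rw [Real.tanh_eq_sinh_div_cosh, div_pow, hs2]
    field_simp
  rw [hT] at hb ⊢
  set c : ℝ := Real.cosh (l / 2)
  have hc0 : 0 < c := by linarith
  -- With `y = 1 / c` and `tanh² = 1 - y²`, the upper bound on the trace is exactly `cos b < 1 - y²
  -- - y`. The lower bound is `cos b > -1 - y + y²`, which follows from `cos b ≥ -1` and `0 < y <
  -- 1`.
  obtain ⟨y, hy⟩ : ∃ y, y = 1 / c := ⟨_, rfl⟩
  have hcy : c * y = 1 := by rw [hy]; field_simp
  have hy0 : 0 < y := by rw [hy]; positivity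
  have hy1 : y < 1 := by nlinarith
  rw [show 1 / c ^ 2 = y ^ 2 by rw [hy]; ring] at hb ⊢
  rw [← hy] at hb
  have hcos : Real.cos b < 1 - y ^ 2 - y := by
    have h := Real.cos_lt_cos_of_nonneg_of_le_pi (Real.arccos_nonneg _) hbπ.le hb
    rwa [Real.cos_arccos (by nlinarith) (by nlinarith)] at h
  have hcos1 : -1 ≤ Real.cos b := Real.neg_one_le_cos b
  have hpos : 0 < 1 - y ^ 2 := by nlinarith
  have hcy2 : c * y ^ 2 = y := by linear_combination y * hcy
  rw [abs_lt]
  constructor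
  · rw [lt_sub_iff_add_lt, lt_div_iff₀ hpos]
    nlinarith
  · rw [sub_lt_iff_lt_add, div_lt_iff₀ hpos]
    nlinarith

end OncePuncturedTorus

theorem mainTheorem9 (l : ℝ) (hl : 0 < l) (n : ℤ) (b : ℝ) :
    (2 * Real.arccos (Real.tanh (l / 2)) < b → b < Real.pi →
      ∀ x : OncePuncturedTorus.CharacterVariety,
        OncePuncturedTorus.HasFenchelNielsenCoordinates x (l : ℂ)
            ((n : ℂ) * (l : ℂ) + (b : ℂ) * Complex.I) →
          OncePuncturedTorus.EllipticHolonomy x (OncePuncturedTorus.curveInt (-n)) ∧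
          x ∉ OncePuncturedTorus.QF) ∧
    (Real.arccos (Real.tanh (l / 2) ^ 2 - 1 / Real.cosh (l / 2)) < b → b < Real.pi →
      ∀ x : OncePuncturedTorus.CharacterVariety,
        OncePuncturedTorus.HasFenchelNielsenCoordinates x (l : ℂ)
            (((n : ℂ) + 1 / 2) * (l : ℂ) + (b : ℂ) * Complex.I) →
          OncePuncturedTorus.EllipticHolonomy x (OncePuncturedTorus.curveHalf (-n - 1)) ∧
          x ∉ OncePuncturedTorus.QF) := by
  refine ⟨fun hb hbπ x hx => ?_, fun hb hbπ x hx => ?_⟩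
  · refine OncePuncturedTorus.ellipticHolonomy_and_notMem_QF
      (OncePuncturedTorus.abs_two_mul_cos_div_tanh_lt_two hl hb hbπ) fun ρ hρ => ?_
    obtain ⟨W, hW, htr⟩ := hx.exists_lift_curveInt hρ (-n)
    refine ⟨W, hW, ?_⟩
    rw [htr, show ((n : ℂ) * l + b * Complex.I + ((-n : ℤ) : ℂ) * l) / 2 = b / 2 * Complex.I by
      push_cast; ring, Complex.cosh_mul_I]
    push_cast
    rfl
  · refine OncePuncturedTorus.ellipticHolonomy_and_notMem_QF
      (OncePuncturedTorus.abs_trace_half_lt_two hl hb hbπ) fun ρ hρ => ?_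
    -- The slope `-n - 1/2` is `m + 1/2` for `m = -n - 1`; then `(n + 1/2) + m + 1/2 = 0` removes
    -- `l` from the argument of `cosh`.
    obtain ⟨W, hW, htr⟩ := hx.exists_lift_curveHalf hρ (-n - 1)
    refine ⟨W, hW, ?_⟩
    rw [htr, show ((n : ℂ) + 1 / 2) * l + b * Complex.I + ((-n - 1 : ℤ) : ℂ) * l + l / 2 =
      b * Complex.I by push_cast; ring, Complex.cosh_mul_I]
    push_cast
    rfl
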